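/- A cubespace is a topological space $X$ with closed sets $C^n(X)\subseteq X^{\{0,1\}^n}$ ($n\ge 0$) of *cubes* such that $C^0(X)=X$, and $c\circ\rho\in C^m(X)$ whenever $c\in C^n(X)$ and $\rho:\{0,1\}^m\to\{0,1\}^n$ is a morphism of discrete cubes, i.e. a map each of whose coordinates is one of $0$, $1$, $\omega_i$, $1-\omega_i$. It is *ergodic* if $C^1(X)=X^{\{0,1\}}$. It is a *nilspace of degree (at most) $s$* if (i) for every $k\ge 1$, every map $\lambda:\{0,1\}^k\setminus\{\vec 1\}\to X$ whose restriction to each face $\{\omega:\omega_i=0\}$ is a $(k-1)$-cube extends to a $k$-cube, and (ii) any two $(s+1)$-cubes that agree on $\{0,1\}^{s+1}\setminus\{\vec 1\}$ are equal. For an abelian group $A$ and $f:X\to A$ put $\partial^\ell f:C^\ell(X)\to A$, $\partial^\ell f(c)=\sum_{\omega\in\{0,1\}^\ell}(-1)^{|\omega|}f(c(\omega))$, where $|\omega|$ is the number of coordinates of $\omega$ equal to $1$. **Theorem.** Let $A$ be a compact abelian Lie group (not necessarily connected), equipped with a metric $d_A$ inducing its topology, and let integers $s\ge 0$ and $\ell\ge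 1$ be given. Then there exists $\varepsilon=\varepsilon(s,\ell,A)>0$ such that the following holds. Suppose that $X$ is a compact Hausdorff ergodic nilspace of degree $s$, and $f:X\to A$ is a continuous function such that $d_A(f(x),f(x'))\le\varepsilon$ for all $x,x'\in X$ and $\partial^\ell f$ is identically zero on $C^\ell(X)$. Then $f$ is constant. -/

import Mathlib

open scoped Manifold ContDiff

/-- A morphism of discrete cubes `{0,1}^m → {0,1}^n`: every coordinate of the output is
`0`, `1`, some `v i`, or some `1 - v i` (`false` stands for `0` and `true` for `1`). -/
def IsCubeMorphism {m n : ℕ} (ρ : (Fin m → Bool) → (Fin n → Bool)) : Prop :=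
  ∀ j : Fin n, (∃ b : Bool, ∀ v, ρ v j = b) ∨ (∃ i : Fin m, ∀ v, ρ v j = v i) ∨
    (∃ i : Fin m, ∀ v, ρ v j = !(v i))

/-- A cubespace structure on a topological space `X`: closed sets `C^n(X) ⊆ X^{{0,1}^n}` of
cubes with `C^0(X) = X`, stable under composition with morphisms of discrete cubes. -/
structure Cubespace (X : Type*) [TopologicalSpace X] where
  cubes : ∀ n : ℕ, Set ((Fin n → Bool) → X)
  isClosed_cubes : ∀ n, IsClosed (cubes n)
  cubes_zero : cubes 0 = Set.univ
  comp_mem : ∀ {m n : ℕ} (ρ : (Fin m → Bool) → (Fin n → Bool)), IsCubeMorphism ρ →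
    ∀ c ∈ cubes n, c ∘ ρ ∈ cubes m

namespace Cubespace

variable {X : Type*} [TopologicalSpace X]

/-- Ergodicity: every pair of points is a `1`-cube. -/
def IsErgodic (C : Cubespace X) : Prop := C.cubes 1 = Set.univ

/-- `(k+1)`-completion: every `(k+1)`-corner extends to a cube.  A corner is a map on
`{0,1}^{k+1} \ {(1,…,1)}` whose restriction to each face `{v | v i = 0}` is a cube; it is
represented by a function `q` on `{0,1}^{k+1}` whose value at `(1,…,1)` is never used. -/
def HasCompletion (C : Cubespace X) (k : ℕ) : Prop :=
  ∀ q : (Fin (k + 1) → Bool) → X,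
    (∀ i : Fin (k + 1), (fun v : Fin k → Bool => q (i.insertNth false v)) ∈ C.cubes k) →
    ∃ c ∈ C.cubes (k + 1), ∀ v, v ≠ (fun _ => true) → c v = q v

/-- `k`-uniqueness: a `k`-cube is determined by its values away from `(1,…,1)`. -/
def HasUniqueness (C : Cubespace X) (k : ℕ) : Prop :=
  ∀ c ∈ C.cubes k, ∀ c' ∈ C.cubes k, (∀ v, v ≠ (fun _ => true) → c v = c' v) → c = c'

/-- A nilspace of degree (at most) `s`: a cubespace in which all corners of all dimensions
`k + 1 ≥ 1` can be completed, and completion of `(s+1)`-corners is unique. -/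
structure IsNilspace (C : Cubespace X) (s : ℕ) : Prop where
  completion : ∀ k, C.HasCompletion k
  uniqueness : C.HasUniqueness (s + 1)

/-- The derivative `∂^ℓ f : C^ℓ(X) → A`, `c ↦ ∑_v (-1)^{|v|} f (c v)`, where `|v|` is the
number of coordinates of `v` equal to `1`. -/
def coboundary {A : Type*} [AddCommGroup A] (C : Cubespace X) (l : ℕ) (f : X → A) :
    C.cubes l → A :=
  fun c => ∑ v : Fin l → Bool,
    ((-1 : ℤ) ^ (Finset.univ.filter (fun i => v i = true)).card) • f (c.1 v)

end Cubespace

/-! Any two points `x`, `y` are the first two terms of a sequence `g` for which `v ↦ g |v|` is a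
cube in every dimension: by symmetry all lower faces of the next corner coincide, so completion
supplies one new term at a time. Along `g`, `f` is a polynomial sequence in `A` of small
oscillation. Such a sequence is constant: by induction on the degree its differences equal a
constant `b`, so all multiples `k • b` are small, and a Lie group has no small subgroups since
doubling expands near `0`. -/

open Filter Topology in
/-- Near a fixed point at which the derivative is multiplication by two, a map expands distances
to that point by a factor of at least `3 / 2`. -/
lemma eventually_norm_sub_ge_of_hasFDerivAt_two {E : Type*} [NormedAddCommGroup E]
    [NormedSpace ℝ E] {F : E → E} {p : E} (hp : F p = p)
    (hF : HasFDerivAt F (ContinuousLinearMap.id ℝ E + ContinuousLinearMap.id ℝ E) p) :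
    ∀ᶠ x in 𝓝 p, 3 / 2 * ‖x - p‖ ≤ ‖F x - p‖ := by
  have h := hF.isLittleO.def (show (0 : ℝ) < 1 / 2 by norm_num)
  filter_upwards [h] with x hx
  rw [hp] at hx
  have h2 : ‖(x - p) + (x - p)‖ = 2 * ‖x - p‖ := by
    rw [← two_smul ℝ (x - p), norm_smul]; norm_num
  have h3 : (x - p) + (x - p) = (F x - p) - (F x - p - ((x - p) + (x - p))) := by abel
  have h4 : ‖(x - p) + (x - p)‖ ≤ ‖F x - p‖ + ‖F x - p - ((x - p) + (x - p))‖ := by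
    conv_lhs => rw [h3]
    exact norm_sub_le _ _
  simp only [add_apply, ContinuousLinearMap.id_apply] at hx
  linarith

/-- The derivative at `0` of the doubling map of a Lie group is multiplication by two. -/
lemma hasMFDerivAt_add_self (n : ℕ) {A : Type*} [AddCommGroup A] [TopologicalSpace A]
    [ChartedSpace (EuclideanSpace ℝ (Fin n)) A] [LieAddGroup (𝓡 n) ∞ A] :
    HasMFDerivAt (𝓡 n) (𝓡 n) (fun a : A => a + a) 0
      (ContinuousLinearMap.id ℝ (EuclideanSpace ℝ (Fin n)) +
        ContinuousLinearMap.id ℝ (EuclideanSpace ℝ (Fin n))) := by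
  have hl : HasMFDerivAt (𝓡 n) (𝓡 n) (fun a : A => a + 0) 0
      (ContinuousLinearMap.id ℝ (EuclideanSpace ℝ (Fin n))) :=
    (hasMFDerivAt_id (I := 𝓡 n) (0 : A)).congr_of_eventuallyEq (.of_forall add_zero)
  have hr : HasMFDerivAt (𝓡 n) (𝓡 n) (fun a : A => 0 + a) 0
      (ContinuousLinearMap.id ℝ (EuclideanSpace ℝ (Fin n))) :=
    (hasMFDerivAt_id (I := 𝓡 n) (0 : A)).congr_of_eventuallyEq (.of_forall zero_add)
  have hadd : MDifferentiableAt ((𝓡 n).prod (𝓡 n)) (𝓡 n) (fun q : A × A => q.1 + q.2)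
      ((0 : A), (0 : A)) :=
    (contMDiff_add (𝓡 n) ∞).mdifferentiable (by simp) _
  have hd : HasMFDerivAt (𝓡 n) ((𝓡 n).prod (𝓡 n)) (fun a : A => (a, a)) 0 _ :=
    (hasMFDerivAt_id (I := 𝓡 n) (0 : A)).prodMk (hasMFDerivAt_id (I := 𝓡 n) (0 : A))
  -- Doubling is addition after the diagonal, so its derivative is the sum of the two partial
  -- derivatives `hl` and `hr`.
  have hc := HasMFDerivAt.comp (f := fun a : A => (a, a)) (0 : A) hadd.hasMFDerivAt hd
  refine hc.congr_mfderiv ?_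
  ext1 v
  exact (mfderiv_prod_eq_add_apply hadd).trans
    (congrArg₂ (fun x y : EuclideanSpace ℝ (Fin n) => x + y)
      (DFunLike.congr_fun hl.mfderiv v) (DFunLike.congr_fun hr.mfderiv v))

open Filter Topology in
/-- A Lie group has no small subgroups. -/
lemma exists_nhds_zero_eq_zero_of_nsmul_mem (n : ℕ) {A : Type*} [AddCommGroup A]
    [TopologicalSpace A] [ChartedSpace (EuclideanSpace ℝ (Fin n)) A] [LieAddGroup (𝓡 n) ∞ A] :
    ∃ V ∈ 𝓝 (0 : A), ∀ b : A, (∀ k : ℕ, k • b ∈ V) → b = 0 := by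
  set φ := extChartAt (𝓡 n) (0 : A) with hφ
  obtain ⟨_, hD⟩ := hasMFDerivAt_add_self n (A := A)
  have h0 : φ.symm (φ 0) = 0 := extChartAt_to_inv (I := 𝓡 n) (0 : A)
  have hw : writtenInExtChartAt (𝓡 n) (𝓡 n) (0 : A) (fun a : A => a + a) =
      fun x => φ (φ.symm x + φ.symm x) := by
    ext x : 1
    simp [writtenInExtChartAt, hφ]
  rw [hw] at hD
  rw [ModelWithCorners.range_eq_univ] at hD
  have hev := eventually_norm_sub_ge_of_hasFDerivAt_two (p := φ 0)
    (by simp only [h0, add_zero]) (hasFDerivWithinAt_univ.1 hD)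
  have hc : ContinuousAt φ 0 := continuousAt_extChartAt (I := 𝓡 n) (0 : A)
  -- `V` is the part of the chart domain where doubling expands by `3 / 2` and the chart stays
  -- within distance `1` of `φ 0`; the multiples `2 ^ j • b` of a nonzero `b` would leave it.
  refine ⟨_, inter_mem (inter_mem (hc.eventually hev) (extChartAt_source_mem_nhds (I := 𝓡 n) 0))
    (hc (Metric.ball_mem_nhds _ one_pos)), fun b hb => ?_⟩
  have hsrc : ∀ k : ℕ, φ.symm (φ (k • b)) = k • b := fun k => φ.left_inv (hb k).1.2
  have hstep : ∀ k : ℕ, 3 / 2 * ‖φ (k • b) - φ 0‖ ≤ ‖φ ((2 * k) • b) - φ 0‖ := by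
    intro k
    have h1 : 3 / 2 * ‖φ (k • b) - φ 0‖ ≤
        ‖φ (φ.symm (φ (k • b)) + φ.symm (φ (k • b))) - φ 0‖ := (hb k).1.1
    rwa [hsrc, ← two_nsmul, ← mul_nsmul'] at h1
  have hpow : ∀ j : ℕ, (3 / 2 : ℝ) ^ j * ‖φ b - φ 0‖ ≤ ‖φ ((2 ^ j) • b) - φ 0‖ := by
    intro j
    induction j with
    | zero => simp
    | succ j ih =>
      have := hstep (2 ^ j)
      rw [pow_succ' 2 j, pow_succ' (3 / 2 : ℝ) j, mul_assoc]
      linarith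
  have hlt : ∀ j : ℕ, (3 / 2 : ℝ) ^ j * ‖φ b - φ 0‖ < 1 := fun j =>
    (hpow j).trans_lt (mem_ball_iff_norm.1 (hb (2 ^ j)).2)
  have hzero : ‖φ b - φ 0‖ = 0 := by
    by_contra hne
    have hpos : 0 < ‖φ b - φ 0‖ := lt_of_le_of_ne (norm_nonneg _) (Ne.symm hne)
    obtain ⟨j, hj⟩ := pow_unbounded_of_one_lt (1 / ‖φ b - φ 0‖) (show (1 : ℝ) < 3 / 2 by norm_num)
    rw [div_lt_iff₀ hpos] at hj
    exact lt_asymm hj (hlt j)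
  have h1 := hsrc 1
  rw [one_nsmul, sub_eq_zero.1 (norm_eq_zero.1 hzero), h0] at h1
  exact h1.symm

/-! ### Polynomial sequences of small oscillation -/

open Topology in
/-- In a group without small subgroups, a polynomial sequence of small oscillation is constant. -/
lemma exists_nhds_zero_fwdDiff_eq_zero {A : Type*} [AddCommGroup A] [TopologicalSpace A]
    [IsTopologicalAddGroup A]
    (hA : ∃ V ∈ 𝓝 (0 : A), ∀ b : A, (∀ k : ℕ, k • b ∈ V) → b = 0) (l : ℕ) :
    ∃ W ∈ 𝓝 (0 : A), ∀ a : ℕ → A, (∀ i j, a i - a j ∈ W) →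
      ((fwdDiff 1)^[l + 1] a = 0) → fwdDiff 1 a = 0 := by
  induction l with
  | zero => exact ⟨Set.univ, Filter.univ_mem, fun a _ h => h⟩
  | succ l ih =>
    obtain ⟨V, hV, hVA⟩ := hA
    obtain ⟨W, hW, hWa⟩ := ih
    have hsub : (fun q : A × A => q.1 - q.2) ⁻¹' W ∈ 𝓝 ((0 : A), (0 : A)) :=
      (continuous_fst.sub continuous_snd).continuousAt.preimage_mem_nhds (by simpa using hW)
    rw [nhds_prod_eq] at hsub
    obtain ⟨W', hW', hsub⟩ := Filter.mem_prod_same_iff.1 hsub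
    -- `W'` passes small oscillation on to the difference sequence; `V` then rules out a nonzero
    -- constant difference.
    refine ⟨W' ∩ V, Filter.inter_mem hW' hV, fun a ha hl => ?_⟩
    have hdd : fwdDiff 1 (fwdDiff 1 a) = 0 := by
      refine hWa _ (fun i j => ?_) hl
      exact hsub (Set.mk_mem_prod (ha (i + 1) i).1 (ha (j + 1) j).1)
    have hconst : ∀ k, a (k + 1) - a k = a 1 - a 0 := by
      intro k
      induction k with
      | zero => rfl
      | succ k ihk =>
        have := congrFun hdd k
        simp only [fwdDiff, Pi.zero_apply] at this
        rw [← ihk]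
        exact sub_eq_zero.1 this
    have hsum : ∀ k : ℕ, k • (a 1 - a 0) = a k - a 0 := by
      intro k
      induction k with
      | zero => simp
      | succ k ihk => rw [succ_nsmul, ihk, ← hconst k]; abel
    have hzero := hVA (a 1 - a 0) fun k => by rw [hsum]; exact (ha k 0).2
    ext k
    exact (hconst k).trans hzero

/-! ### Weights on discrete cubes -/

/-- The number of ones of a vertex of a discrete cube. -/
def boolWeight {m : ℕ} (v : Fin m → Bool) : ℕ :=
  (Finset.univ.filter (fun i => v i = true)).card

lemma boolWeight_eq_sum {m : ℕ} (v : Fin m → Bool) :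
    boolWeight v = ∑ i, if v i = true then 1 else 0 := by
  rw [boolWeight, Finset.card_filter]

lemma boolWeight_le {m : ℕ} (v : Fin m → Bool) : boolWeight v ≤ m :=
  (Finset.card_filter_le _ _).trans (by simp)

lemma boolWeight_true (m : ℕ) : boolWeight (fun _ : Fin m => true) = m := by
  simp [boolWeight]

lemma boolWeight_lt {m : ℕ} {v : Fin m → Bool} (hv : v ≠ fun _ => true) : boolWeight v < m := by
  refine (boolWeight_le v).lt_of_ne fun h => hv ?_
  have h1 : Finset.univ.filter (fun i => v i = true) = Finset.univ :=
    Finset.eq_univ_of_card _ (by simpa [boolWeight] using h)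
  funext i
  simpa using Finset.mem_univ i |> h1.symm.subset

lemma boolWeight_insertNth_false {m : ℕ} (i : Fin (m + 1)) (v : Fin m → Bool) :
    boolWeight (i.insertNth false v : Fin (m + 1) → Bool) = boolWeight v := by
  simp [boolWeight_eq_sum, Fin.sum_univ_succAbove _ i]

lemma boolWeight_append {m k : ℕ} (u : Fin m → Bool) (v : Fin k → Bool) :
    boolWeight (Fin.append u v) = boolWeight u + boolWeight v := by
  simp only [boolWeight_eq_sum, Fin.sum_univ_add, Fin.append_left, Fin.append_right]

/-- The alternating sum of a sequence of weights over a discrete cube is an iterated difference. -/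
lemma sum_neg_one_pow_boolWeight_smul {A : Type*} [AddCommGroup A] (a : ℕ → A) (l m : ℕ) :
    ∑ v : Fin l → Bool, ((-1 : ℤ) ^ boolWeight v) • a (m + boolWeight v) =
      (-1 : ℤ) ^ l • (fwdDiff 1)^[l] a m := by
  induction l generalizing m with
  | zero => simp [boolWeight]
  | succ l ih =>
    rw [← (Fin.consEquiv fun _ => Bool).sum_comp, Fintype.sum_prod_type]
    have hw : ∀ (b : Bool) (v : Fin l → Bool), boolWeight (Fin.cons b v : Fin (l + 1) → Bool) =
        (if b = true then 1 else 0) + boolWeight v := by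
      intro b v
      simp only [boolWeight_eq_sum, Fin.sum_univ_succ, Fin.cons_zero, Fin.cons_succ]
    have ht : ∀ v : Fin l → Bool,
        ((-1 : ℤ) ^ boolWeight (Fin.cons true v : Fin (l + 1) → Bool)) •
          a (m + boolWeight (Fin.cons true v : Fin (l + 1) → Bool)) =
        -(((-1 : ℤ) ^ boolWeight v) • a (m + 1 + boolWeight v)) := by
      intro v
      rw [hw, if_pos rfl, pow_add, pow_one, neg_one_mul, neg_smul, add_assoc]
    have hf : ∀ v : Fin l → Bool,
        ((-1 : ℤ) ^ boolWeight (Fin.cons false v : Fin (l + 1) → Bool)) •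
          a (m + boolWeight (Fin.cons false v : Fin (l + 1) → Bool)) =
        ((-1 : ℤ) ^ boolWeight v) • a (m + boolWeight v) := by
      intro v
      rw [hw, if_neg Bool.false_ne_true, zero_add]
    rw [Fintype.sum_bool]
    refine (congrArg₂ (· + ·) (Finset.sum_congr rfl fun v _ => ht v)
      (Finset.sum_congr rfl fun v _ => hf v)).trans ?_
    rw [Finset.sum_neg_distrib, ih, ih, Function.iterate_succ_apply', fwdDiff, pow_succ, mul_neg_one,
      neg_smul, smul_sub]
    abel

/-! ### Cubes that depend only on the weight -/

namespace Cubespace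

variable {X : Type*} [TopologicalSpace X] {C : Cubespace X}

/-- A cube depending on the weight only extends to a cube of the next dimension with the same
property. -/
lemma exists_weight_cube_succ (hC : ∀ k, C.HasCompletion k) {m : ℕ} {g : ℕ → X}
    (hg : (fun v : Fin m → Bool => g (boolWeight v)) ∈ C.cubes m) :
    ∃ g' : ℕ → X, (fun v : Fin (m + 1) → Bool => g' (boolWeight v)) ∈ C.cubes (m + 1) ∧
      ∀ k ≤ m, g' k = g k := by
  obtain ⟨c, hc, hcg⟩ := hC m (fun v => g (boolWeight v)) fun i => by
    simpa only [boolWeight_insertNth_false] using hg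
  refine ⟨Function.update g (m + 1) (c fun _ => true), ?_, fun k hk =>
    Function.update_of_ne (by omega) _ _⟩
  convert hc using 1
  funext v
  by_cases hv : v = fun _ => true
  · subst hv
    rw [boolWeight_true, Function.update_self]
  · rw [Function.update_of_ne (boolWeight_lt hv).ne, hcg v hv]

/-- Any two points are the first two terms of a sequence all of whose initial segments, read
along weights, are cubes. -/
lemma exists_seq_weight_cubes (hC : ∀ k, C.HasCompletion k) (hE : C.IsErgodic) (x y : X) :
    ∃ g : ℕ → X, g 0 = x ∧ g 1 = y ∧
      ∀ m, (fun v : Fin m → Bool => g (boolWeight v)) ∈ C.cubes m := by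
  have h1 : (fun v : Fin 1 → Bool => (fun k => if k = 0 then x else y) (boolWeight v)) ∈
      C.cubes 1 := by
    rw [hE]; trivial
  choose! next hnext hagree using fun (m : ℕ) (g : ℕ → X)
    (hg : (fun v : Fin m → Bool => g (boolWeight v)) ∈ C.cubes m) => exists_weight_cube_succ hC hg
  -- `G m` is an `(m + 1)`-cube whose terms up to index `m + 1` never change later, so the diagonal
  -- `G k k` agrees with each `G m` on all weights that occur.
  let G : ℕ → ℕ → X := fun m =>
    Nat.rec (fun k => if k = 0 then x else y) (fun j g => next (j + 1) g) m
  have hG : ∀ m, (fun v : Fin (m + 1) → Bool => G m (boolWeight v)) ∈ C.cubes (m + 1) := by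
    intro m
    induction m with
    | zero => exact h1
    | succ m ih => exact hnext (m + 1) (G m) ih
  have hstable : ∀ i j k, i ≤ j → k ≤ i + 1 → G j k = G i k := by
    intro i j k hij hk
    induction j, hij using Nat.le_induction with
    | base => rfl
    | succ j hij ih => rw [← ih]; exact hagree _ _ (hG j) k (by omega)
  refine ⟨fun k => G k k, rfl, hstable 0 1 1 zero_le_one le_rfl, fun m => ?_⟩
  cases m with
  | zero => rw [C.cubes_zero]; trivial
  | succ m =>
    convert hG m using 1
    funext v
    rcases (boolWeight_le v).lt_or_eq with h | h
    · exact (hstable _ _ _ (Nat.lt_succ_iff.1 h) (Nat.le_succ _)).symm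
    · simp only [h]
      exact hstable _ _ _ (Nat.le_succ _) le_rfl

/-- A function with vanishing `l`-th derivative restricts to a polynomial sequence along any
sequence whose initial segments, read along weights, are cubes. -/
lemma fwdDiff_iter_eq_zero_of_coboundary {A : Type*} [AddCommGroup A] {l : ℕ} {f : X → A}
    (hf : C.coboundary l f = 0) {g : ℕ → X}
    (hg : ∀ m, (fun v : Fin m → Bool => g (boolWeight v)) ∈ C.cubes m) :
    (fwdDiff 1)^[l] (f ∘ g) = 0 := by
  funext m
  -- Freezing `m` coordinates at `1` shifts the weight by `m`, giving the difference at `m`.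
  let ρ : (Fin l → Bool) → (Fin (m + l) → Bool) := Fin.append fun _ => true
  have hρ : IsCubeMorphism ρ := by
    intro j
    induction j using Fin.addCases with
    | left i => exact Or.inl ⟨true, fun v => Fin.append_left _ _ i⟩
    | right i => exact Or.inr (Or.inl ⟨i, fun v => Fin.append_right _ _ i⟩)
  have h := congrFun hf ⟨_, C.comp_mem ρ hρ _ (hg (m + l))⟩
  simp only [coboundary, Function.comp_apply, ρ, boolWeight_append, boolWeight_true,
    Pi.zero_apply] at h
  have h' := (sum_neg_one_pow_boolWeight_smul (f ∘ g) l m).symm.trans h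
  rcases neg_one_pow_eq_or ℤ l with hs | hs <;> simpa [hs] using h'

end Cubespace

theorem theorem5p2 {n : ℕ} {A : Type*} [AddCommGroup A] [MetricSpace A] [CompactSpace A]
    [ChartedSpace (EuclideanSpace ℝ (Fin n)) A] [LieAddGroup (𝓡 n) ∞ A]
    (s l : ℕ) (hl : 1 ≤ l) :
    ∃ ε : ℝ, 0 < ε ∧
      ∀ (X : Type*) [TopologicalSpace X] [CompactSpace X] [T2Space X] (C : Cubespace X),
        C.IsErgodic → C.IsNilspace s →
        ∀ f : X → A, Continuous f → (∀ x x' : X, dist (f x) (f x') ≤ ε) →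
          C.coboundary l f = 0 →
          ∃ a : A, ∀ x : X, f x = a := by
  have : IsTopologicalAddGroup A := topologicalAddGroup_of_lieAddGroup (𝓡 n) ∞
  obtain ⟨l, rfl⟩ := Nat.exists_eq_add_of_le' hl
  obtain ⟨W, hW, hWa⟩ := exists_nhds_zero_fwdDiff_eq_zero
    (exists_nhds_zero_eq_zero_of_nsmul_mem n (A := A)) l
  -- The metric need not be translation invariant; compactness of `A` makes this neighbourhood of
  -- the diagonal an entourage.
  have hunif : (fun q : A × A => q.1 - q.2) ⁻¹' W ∈ uniformity A := by
    rw [← nhdsSet_diagonal_eq_uniformity, mem_nhdsSet_iff_forall]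
    rintro ⟨x, y⟩ hxy
    obtain rfl : x = y := hxy
    exact (continuous_fst.sub continuous_snd).continuousAt.preimage_mem_nhds (by simpa using hW)
  obtain ⟨δ, hδ, hδW⟩ := Metric.mem_uniformity_dist.1 hunif
  refine ⟨δ / 2, half_pos hδ, fun X _ _ _ C hE hC f _ hosc hf => ?_⟩
  have heq : ∀ x y, f y = f x := by
    intro x y
    obtain ⟨g, rfl, rfl, hg⟩ := C.exists_seq_weight_cubes hC.completion hE x y
    have h := hWa (f ∘ g) (fun i j => hδW ((hosc _ _).trans_lt (half_lt_self hδ)))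
      (C.fwdDiff_iter_eq_zero_of_coboundary hf hg)
    exact sub_eq_zero.1 (congrFun h 0)
  rcases isEmpty_or_nonempty X with hX | ⟨⟨x⟩⟩
  · exact ⟨0, fun x => hX.elim x⟩
  · exact ⟨f x, heq x⟩
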